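/- An ascent of a string of integers $x_1\cdots x_n$ is a position $j$ with $1\le j<n$ and $x_j<x_{j+1}$; $\mathrm{asc}(x_1\cdots x_n)$ denotes the number of ascents. An ascent sequence of length $n$ is a string $x_1\cdots x_n$ of non-negative integers with $x_1=0$ and $x_i\le \mathrm{asc}(x_1\cdots x_{i-1})+1$ for $1<i\le n$. The reduction of a string is obtained by replacing every occurrence of its $i$-th smallest distinct letter by $i-1$. A string contains a pattern $p$ if it has a (not necessarily contiguous) subsequence whose reduction is $p$, and it avoids $p$ otherwise. Theorem. For every $n\ge 1$, the number of ascent sequences of length $n$ that avoid both patterns $201$ and $210$ is $$\sum_{k=0}^{n-1}\binom{n-1}{k}C_k,$$ where $C_k=\frac{1}{k+1}\binom{2k}{k}$ is the $k$-th Catalan number. -/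

import Mathlib

/-- The number of ascents of an integer string: positions `j` such that the letter at position `j`
is smaller than the letter at position `j + 1` (positions are counted from `0`). -/
def asc (x : List ℕ) : ℕ :=
  ((Finset.range x.length).filter
    (fun j => ∃ h : j + 1 < x.length, x[j] < x[j + 1])).card

/-- A string of non-negative integers is an ascent sequence if its first letter is `0` and every
later letter is at most one more than the number of ascents of the prefix before it. -/
def IsAscentSequence (x : List ℕ) : Prop :=
  (∀ h : 0 < x.length, x[0] = 0) ∧
    ∀ (i : ℕ) (h : i < x.length), 0 < i → x[i] ≤ asc (x.take i) + 1

/-- The reduction of a string: its `i`-th smallest distinct letter is replaced by `i - 1`, that is,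
every letter is replaced by the number of distinct letters of the string below it. -/
def red (x : List ℕ) : List ℕ :=
  x.map fun a => (x.toFinset.filter (fun b => b < a)).card

/-- The string `x` contains the pattern `p` if some (not necessarily contiguous) subsequence of `x`
has reduction `p`. -/
def ContainsPattern (x p : List ℕ) : Prop :=
  ∃ s : List ℕ, s.Sublist x ∧ red s = p

/-- The set of ascent sequences of length `n` that avoid all patterns in `B`. -/
def ascentAvoiders (B : Set (List ℕ)) (n : ℕ) : Set (List ℕ) :=
  {x | x.length = n ∧ IsAscentSequence x ∧ ∀ p ∈ B, ¬ ContainsPattern x p}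

/-!
A string avoids `201` and `210` exactly when, after any letter `c`, at most one value below `c`
occurs.  Hence whether a letter `v` may be appended to a valid prefix depends only on a small state:
the number `a` of ascents, the last letter, the maximum `M`, and the finite set `L` of letters below
`M` that are still admissible.  The letter `v` may be appended iff `v ∈ L` or `M ≤ v ≤ a + 1`; if
`v < M`, then `L` becomes `{v}`, and otherwise `L` gains the letters of `[M, v)`
(`Tracks.append_valid_iff`, `Tracks.append`).

Two kinds of states arise: the last letter is `M`, or it lies below `M` and `L` consists of it
alone.  Either way the number of continuations depends only on `h = a + 1 - M` and, in the first
case, on `|L|`.  In every state exactly one continuation, repeating the last letter, leaves the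
state unchanged.  Disregarding these idle steps makes the count of continuations of length `n` the
binomial transform of the count of continuations without idle steps, which is where the factor
`(n - 1).choose k` comes from.

Let `C` be the Catalan generating function. The number of continuations of length `k` without idle
steps is `G k h + |L| * H k h` in a state of the first kind and `G k (h + 1)` in one of the second
kind, where, as power series in `x`, `∑ G k h x ^ k = 1 + x (C ^ 2 + C ^ 4 + ⋯ + C ^ (2 h))` and
`∑ H k h x ^ k = x C ^ (2 h + 1)`; here `G` is `contTop` and `H` is `contLow`. The
recurrences for these follow from `C ^ (m + 1) = C ^ m + x C ^ (m + 2)`.  The string `0` has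
`L = ∅` and `h = 1`, and `∑ G k 1 x ^ k = 1 + x C ^ 2 = C`.
-/

namespace AscentAvoiders

open Finset

/-! ### Powers of the Catalan series -/

/-- The coefficient of `x ^ k` in the `m`-th power of the Catalan generating function. -/
noncomputable def catalanPow (k m : ℕ) : ℕ :=
  PowerSeries.coeff k (PowerSeries.catalanSeries ^ m)

theorem catalanPow_zero_left (m : ℕ) : catalanPow 0 m = 1 := by
  simp [catalanPow]

theorem catalanPow_succ_zero (k : ℕ) : catalanPow (k + 1) 0 = 0 := by
  simp [catalanPow, PowerSeries.coeff_one]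

theorem catalanPow_one (k : ℕ) : catalanPow k 1 = catalan k := by
  simp [catalanPow]

theorem catalanPow_succ_succ (k m : ℕ) :
    catalanPow (k + 1) (m + 1) = catalanPow (k + 1) m + catalanPow k (m + 2) := by
  have h : PowerSeries.catalanSeries ^ (m + 1) =
      PowerSeries.catalanSeries ^ m + PowerSeries.catalanSeries ^ (m + 2) * PowerSeries.X := by
    calc PowerSeries.catalanSeries ^ (m + 1)
        = PowerSeries.catalanSeries ^ m *
            (PowerSeries.catalanSeries ^ 2 * PowerSeries.X + 1) := by
          rw [PowerSeries.catalanSeries_sq_mul_X_add_one, pow_succ]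
      _ = _ := by ring
  rw [catalanPow, h, map_add, PowerSeries.coeff_succ_mul_X]
  rfl

/-! ### Continuations without idle steps -/

/-- The number of continuations of length `k` without idle steps when the last letter is the
maximum, no smaller letter is admissible, and `h` is the number of admissible new maxima. It is
defined by its closed form; `card_words` justifies the interpretation. -/
noncomputable def contTop : ℕ → ℕ → ℕ
  | 0, _ => 1
  | k + 1, h => ∑ i ∈ range h, catalanPow k (2 * i + 2)

/-- The contribution of each admissible letter below the maximum to the number of continuations of
length `k` without idle steps, when the last letter is the maximum, again in
closed form. -/
noncomputable def contLow : ℕ → ℕ → ℕ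
  | 0, _ => 0
  | k + 1, h => catalanPow k (2 * h + 1)

/-- The partial sums `contLow k 1 + ⋯ + contLow k h`. -/
noncomputable def contLowSum (k h : ℕ) : ℕ := ∑ j ∈ range h, contLow k (j + 1)

theorem contTop_one (k : ℕ) : contTop k 1 = catalan k := by
  cases k with
  | zero => simp [contTop]
  | succ k =>
    have := catalanPow_succ_succ k 0
    rw [catalanPow_succ_zero] at this
    simp only [contTop, sum_range_one, ← catalanPow_one]
    simpa using this.symm

/-- The recurrence `C ^ (m + 1) = C ^ m + x C ^ (m + 2)` summed over `m`, with the even and the odd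
powers on the right collected separately. -/
theorem catalanPow_odd (k h : ℕ) :
    catalanPow k (2 * h + 1) = contTop k (h + 1) + contLowSum k h := by
  cases k with
  | zero => simp [catalanPow_zero_left, contTop, contLowSum, contLow]
  | succ k =>
    induction h with
    | zero =>
      simpa [contTop, contLowSum, catalanPow_succ_zero] using catalanPow_succ_succ k 0
    | succ h ih =>
      have e1 := catalanPow_succ_succ k (2 * h + 1)
      have e2 := catalanPow_succ_succ k (2 * h + 2)
      simp only [contTop, contLowSum, contLow] at ih ⊢
      rw [sum_range_succ, sum_range_succ (fun j => catalanPow k (2 * (j + 1) + 1))]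
      simp only [mul_add, mul_one, add_assoc, Nat.reduceAdd] at *
      omega

theorem contLow_succ (k h : ℕ) : contLow (k + 1) h = contTop k (h + 1) + contLowSum k h :=
  catalanPow_odd k h

theorem contTop_succ_succ (k h : ℕ) :
    contTop (k + 1) (h + 1) =
      contTop (k + 1) h + contTop k (h + 1) + contLowSum k h + contLow k (h + 1) := by
  have key : catalanPow k (2 * h + 2) = catalanPow k (2 * h + 1) + contLow k (h + 1) := by
    cases k with
    | zero => simp [catalanPow_zero_left, contLow]
    | succ k => exact catalanPow_succ_succ k (2 * h + 1)
  rw [contTop, sum_range_succ, key, catalanPow_odd, contTop]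
  ring

/-- Summing over the possible new maxima `M + i + 1`: such a choice adds `i + 1` admissible lower
letters and leaves `h - i` admissible new maxima. -/
theorem sum_newMax (k h l : ℕ) :
    ∑ i ∈ range h, (contTop k (h - i) + (l + i + 1) * contLow k (h - i)) =
      contTop (k + 1) h + l * contLowSum k h := by
  induction h generalizing l with
  | zero => simp [contTop, contLowSum]
  | succ h ih =>
    have e : ∀ i, l + (i + 1) + 1 = l + 1 + i + 1 := fun i => by ring
    rw [sum_range_succ']
    simp only [Nat.add_sub_add_right, e, ih]
    rw [contTop_succ_succ, contLowSum, contLowSum, sum_range_succ]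
    simp only [Nat.sub_zero]
    ring

/-! ### The binomial transform -/

/-- The binomial transform of a sequence. -/
def binomTransform (n : ℕ) (φ : ℕ → ℕ) : ℕ := ∑ k ∈ range (n + 1), n.choose k * φ k

theorem binomTransform_zero (φ : ℕ → ℕ) : binomTransform 0 φ = φ 0 := by
  simp [binomTransform]

theorem binomTransform_succ (n : ℕ) (φ : ℕ → ℕ) :
    binomTransform (n + 1) φ = binomTransform n φ + binomTransform n (fun k => φ (k + 1)) := by
  simp only [binomTransform]
  rw [sum_range_succ', sum_range_succ' (fun k => n.choose k * φ k),
    sum_range_succ (fun k => (n + 1).choose (k + 1) * φ (k + 1)),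
    sum_range_succ (fun k => n.choose k * φ (k + 1))]
  simp only [Nat.choose_succ_succ, add_mul, sum_add_distrib, Nat.choose_succ_self, Nat.choose_self,
    Nat.choose_zero_right]
  ring

theorem binomTransform_add (n : ℕ) (φ ψ : ℕ → ℕ) :
    binomTransform n (fun k => φ k + ψ k) = binomTransform n φ + binomTransform n ψ := by
  simp only [binomTransform, mul_add, sum_add_distrib]

theorem binomTransform_mul (n c : ℕ) (φ : ℕ → ℕ) :
    binomTransform n (fun k => c * φ k) = c * binomTransform n φ := by
  simp only [binomTransform, mul_sum]
  exact sum_congr rfl fun _ _ => by ring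

theorem binomTransform_sum (n : ℕ) (s : Finset ℕ) (φ : ℕ → ℕ → ℕ) :
    binomTransform n (fun k => ∑ i ∈ s, φ i k) = ∑ i ∈ s, binomTransform n (φ i) := by
  simp only [binomTransform, mul_sum]
  exact sum_comm

/-! ### States of a prefix and their continuations -/

/-- What has to be remembered of a nonempty prefix: the number of ascents, the last letter, the
maximum, and the set of letters below the maximum that may still be used. -/
structure State where
  ascents : ℕ
  last : ℕ
  max : ℕ
  low : Finset ℕ

namespace State

/-- The letters by which a prefix with the given state may be continued. -/
def allowed (s : State) : Finset ℕ := s.low ∪ Icc s.max (s.ascents + 1)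

/-- The state after appending the letter `v`. The interval `Ico s.max v` is empty when `v` is
the maximum. -/
def step (s : State) (v : ℕ) : State where
  ascents := s.ascents + if s.last < v then 1 else 0
  last := v
  max := Nat.max s.max v
  low := if v < s.max then {v} else s.low ∪ Ico s.max v

end State

/-- The continuations of length `n` from a state. -/
def words : ℕ → State → Finset (List ℕ)
  | 0, _ => {[]}
  | n + 1, s => s.allowed.biUnion fun v => (words n (s.step v)).image (List.cons v)

theorem card_words_succ (n : ℕ) (s : State) :
    (words (n + 1) s).card = ∑ v ∈ s.allowed, (words n (s.step v)).card := by
  rw [words, card_biUnion]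
  · exact sum_congr rfl fun v _ => card_image_of_injective _ (List.cons_injective)
  · intro v _ w _ hvw
    rw [Function.onFun, disjoint_left]
    intro x hx hx'
    simp only [mem_image] at hx hx'
    obtain ⟨y, _, rfl⟩ := hx
    obtain ⟨z, _, hz⟩ := hx'
    exact hvw (by simpa using (List.cons.inj hz).1.symm)

theorem sum_allowed (f : ℕ → ℕ) (a l M h : ℕ) (L : Finset ℕ) (hL : ∀ v ∈ L, v < M)
    (hh : a + 1 = M + h) :
    ∑ v ∈ (State.mk a l M L).allowed, f v =
      ∑ v ∈ L, f v + (f M + ∑ i ∈ range h, f (M + i + 1)) := by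
  rw [State.allowed, sum_union]
  · congr 1
    simp only [hh]
    rw [← Finset.Ico_add_one_right_eq_Icc, sum_Ico_eq_sum_range]
    rw [show M + h + 1 - M = h + 1 by omega, sum_range_succ', add_comm]
    rfl
  · rw [disjoint_left]
    intro v hv hv'
    have := hL v hv
    simp at hv'
    omega

/-- The numbers of continuations from the two kinds of states: either the last letter is the
maximum, or it is the only admissible letter below the maximum. -/
theorem card_words (n : ℕ) :
    (∀ (a M h : ℕ) (L : Finset ℕ), (∀ v ∈ L, v < M) → a + 1 = M + h →
      (words n ⟨a, M, M, L⟩).card =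
        binomTransform n (fun k => contTop k h + L.card * contLow k h)) ∧
    (∀ a b M h : ℕ, b < M → a + 1 = M + h →
      (words n ⟨a, b, M, {b}⟩).card = binomTransform n (fun k => contTop k (h + 1))) := by
  induction n with
  | zero => simp [words, binomTransform_zero, contTop, contLow]
  | succ n ih =>
    obtain ⟨ihT, ihD⟩ := ih
    -- The contribution of the choices `M + i + 1` of a new maximum, the same for both kinds.
    have new : ∀ (a l M h : ℕ) (L : Finset ℕ), l ≤ M → (∀ v ∈ L, v < M) → a + 1 = M + h →
        ∑ i ∈ range h, (words n ((State.mk a l M L).step (M + i + 1))).card =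
          binomTransform n (fun k => contTop (k + 1) h + L.card * contLowSum k h) := by
      intro a l M h L hl hL hh
      simp only [← sum_newMax]
      rw [binomTransform_sum]
      refine sum_congr rfl fun i hi => ?_
      rw [mem_range] at hi
      have hs : (State.mk a l M L).step (M + i + 1) =
          ⟨a + 1, M + i + 1, M + i + 1, L ∪ Ico M (M + i + 1)⟩ := by
        simp only [State.step, State.mk.injEq]
        refine ⟨by rw [if_pos (by omega)], trivial, max_eq_right (by omega),
          by rw [if_neg (by omega)]⟩
      have hc : (L ∪ Ico M (M + i + 1)).card = L.card + i + 1 := by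
        rw [card_union_of_disjoint, Nat.card_Ico]
        · omega
        · rw [disjoint_left]
          intro v hv hv'
          have := hL v hv
          simp at hv'
          omega
      rw [hs, ihT _ _ (h - i) _ _ (by omega), hc]
      intro v hv
      simp only [mem_union, mem_Ico] at hv
      rcases hv with hv | hv
      · have := hL v hv
        omega
      · exact hv.2
    constructor
    · intro a M h L hL hh
      rw [card_words_succ, sum_allowed _ _ _ _ h _ hL hh, new _ _ _ _ _ le_rfl hL hh,
        binomTransform_succ]
      have hstay : (State.mk a M M L).step M = ⟨a, M, M, L⟩ := by simp [State.step]
      have hlow : ∀ v ∈ L, (words n ((State.mk a M M L).step v)).card =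
          binomTransform n (fun k => contTop k (h + 1)) := by
        intro v hv
        have hv := hL v hv
        have : (State.mk a M M L).step v = ⟨a, v, M, {v}⟩ := by
          simp [State.step, hv, hv.le, hv.not_gt]
        rw [this, ihD _ _ _ h hv hh]
      rw [sum_congr rfl hlow, sum_const, smul_eq_mul, ← binomTransform_mul, hstay,
        ihT _ _ _ _ hL hh, add_left_comm, ← binomTransform_add]
      congr 2
      funext k
      rw [contLow_succ]
      ring
    · intro a b M h hb hh
      have hL : ∀ v ∈ ({b} : Finset ℕ), v < M := by simpa using hb
      rw [card_words_succ, sum_allowed _ _ _ _ h _ hL hh, new _ _ _ _ _ hb.le hL hh,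
        binomTransform_succ, sum_singleton]
      have hstay : (State.mk a b M {b}).step b = ⟨a, b, M, {b}⟩ := by
        simp [State.step, hb, hb.le]
      have hmax : (State.mk a b M {b}).step M = ⟨a + 1, M, M, {b}⟩ := by
        simp [State.step, hb]
      rw [hstay, hmax, ihD _ _ _ h hb hh, ihT _ _ (h + 1) _ hL (by omega), ← binomTransform_add]
      congr 2
      funext k
      rw [contTop_succ_succ, card_singleton]
      ring

/-! ### Avoidance in terms of sublists -/

/-- After any letter, at most one value below that letter occurs. -/
def Avoids (x : List ℕ) : Prop :=
  ∀ c a b, [c, a, b].Sublist x → a < c → b < c → a = b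

theorem red_eq_iff (c a b : ℕ) :
    (red [c, a, b] = [2, 0, 1] ↔ a < b ∧ b < c) ∧ (red [c, a, b] = [2, 1, 0] ↔ b < a ∧ a < c) := by
  -- The letter at each place is replaced by its rank, which is monotone in the letter.
  have mono : ∀ u v : ℕ, u ≤ v → (({c, a, b} : Finset ℕ).filter (· < u)).card ≤
      (({c, a, b} : Finset ℕ).filter (· < v)).card := fun u v huv =>
    card_le_card (monotone_filter_right _ fun w _ hw => lt_of_lt_of_le hw huv)
  have hred : red [c, a, b] = [(({c, a, b} : Finset ℕ).filter (· < c)).card,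
      (({c, a, b} : Finset ℕ).filter (· < a)).card,
      (({c, a, b} : Finset ℕ).filter (· < b)).card] := by
    simp [red]
  rw [hred]
  simp only [List.cons.injEq, and_true]
  refine ⟨⟨fun ⟨hc, ha, hb⟩ => ⟨?_, ?_⟩, fun ⟨h1, h2⟩ => ?_⟩,
    ⟨fun ⟨hc, ha, hb⟩ => ⟨?_, ?_⟩, fun ⟨h1, h2⟩ => ?_⟩⟩
  · by_contra! h
    have := mono _ _ h
    omega
  · by_contra! h
    have := mono _ _ h
    omega
  · have h3 := h1.trans h2
    simp [filter_insert, filter_singleton, h1, h2, h3, h1.not_gt, h2.not_gt, h3.not_gt, h1.ne]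
  · by_contra! h
    have := mono _ _ h
    omega
  · by_contra! h
    have := mono _ _ h
    omega
  · have h3 := h1.trans h2
    simp [filter_insert, filter_singleton, h1, h2, h3, h1.not_gt, h2.not_gt, h3.not_gt, h1.ne']

theorem containsPattern_three_iff (x : List ℕ) (p q r : ℕ) :
    ContainsPattern x [p, q, r] ↔ ∃ c a b, [c, a, b].Sublist x ∧ red [c, a, b] = [p, q, r] := by
  constructor
  · rintro ⟨s, hs, h⟩
    have hl : s.length = 3 := by simpa [red] using congrArg List.length h
    obtain ⟨c, a, b, rfl⟩ := List.length_eq_three.1 hl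
    exact ⟨c, a, b, hs, h⟩
  · rintro ⟨c, a, b, hs, h⟩
    exact ⟨_, hs, h⟩

theorem avoids_iff (x : List ℕ) :
    (∀ p ∈ ({[2, 0, 1], [2, 1, 0]} : Set (List ℕ)), ¬ ContainsPattern x p) ↔ Avoids x := by
  simp only [Set.mem_insert_iff, Set.mem_singleton_iff, forall_eq_or_imp, forall_eq,
    containsPattern_three_iff, (red_eq_iff _ _ _).1, (red_eq_iff _ _ _).2]
  constructor
  · rintro ⟨h1, h2⟩ c a b hs ha hb
    by_contra hab
    rcases lt_or_gt_of_ne hab with h | h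
    · exact h1 ⟨c, a, b, hs, h, hb⟩
    · exact h2 ⟨c, a, b, hs, h, ha⟩
  · intro h
    constructor
    · rintro ⟨c, a, b, hs, h1, h2⟩
      exact h1.ne (h c a b hs (h1.trans h2) h2)
    · rintro ⟨c, a, b, hs, h1, h2⟩
      exact h1.ne' (h c a b hs h2 (h1.trans h2))

theorem sublist_append_singleton_iff (s x : List ℕ) (u v : ℕ) :
    (s ++ [u]).Sublist (x ++ [v]) ↔ (s ++ [u]).Sublist x ∨ s.Sublist x ∧ u = v := by
  rw [← List.reverse_sublist, ← List.reverse_sublist (l₂ := x), ← List.reverse_sublist (l₁ := s)]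
  simp only [List.reverse_append, List.reverse_singleton, List.singleton_append]
  rw [List.sublist_cons_iff]
  simp only [List.cons.injEq]
  constructor
  · rintro (h | ⟨r, ⟨rfl, rfl⟩, h⟩)
    · exact Or.inl h
    · exact Or.inr ⟨h, rfl⟩
  · rintro (h | ⟨h, rfl⟩)
    · exact Or.inl h
    · exact Or.inr ⟨_, ⟨rfl, rfl⟩, h⟩

/-- The letter `v` creates no forbidden pattern when it is appended to `x`. -/
def Compatible (x : List ℕ) (v : ℕ) : Prop :=
  ∀ c a, [c, a].Sublist x → a < c → v < c → a = v

theorem avoids_append_iff (x : List ℕ) (v : ℕ) :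
    Avoids (x ++ [v]) ↔ Avoids x ∧ Compatible x v := by
  have key : ∀ c a b, [c, a, b].Sublist (x ++ [v]) ↔
      [c, a, b].Sublist x ∨ [c, a].Sublist x ∧ b = v := fun c a b =>
    sublist_append_singleton_iff [c, a] x b v
  simp only [Avoids, key, Compatible]
  constructor
  · intro h
    exact ⟨fun c a b hs => h c a b (Or.inl hs), fun c a hs => h c a v (Or.inr ⟨hs, rfl⟩)⟩
  · rintro ⟨h1, h2⟩ c a b (hs | ⟨hs, rfl⟩)
    · exact h1 c a b hs
    · exact h2 c a hs

theorem compatible_append_iff (x : List ℕ) (u v : ℕ) :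
    Compatible (x ++ [u]) v ↔ Compatible x v ∧ ∀ c ∈ x, u < c → v < c → u = v := by
  have key : ∀ c a, [c, a].Sublist (x ++ [u]) ↔ [c, a].Sublist x ∨ c ∈ x ∧ a = u := fun c a => by
    simpa using sublist_append_singleton_iff [c] x a u
  simp only [Compatible, key]
  constructor
  · intro h
    exact ⟨fun c a hs => h c a (Or.inl hs), fun c hc => h c u (Or.inr ⟨hc, rfl⟩)⟩
  · rintro ⟨h1, h2⟩ c a (hs | ⟨hc, rfl⟩)
    · exact h1 c a hs
    · exact h2 c hc

/-! ### Ascent sequences, letter by letter -/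

theorem asc_append (x : List ℕ) (l v : ℕ) :
    asc (x ++ [l] ++ [v]) = asc (x ++ [l]) + if l < v then 1 else 0 := by
  simp only [asc, card_filter]
  have e1 : (x ++ [l] ++ [v]).length = x.length + 1 + 1 := by simp
  have e2 : (x ++ [l]).length = x.length + 1 := by simp
  rw [congrArg range e1, congrArg range e2, sum_range_succ, sum_range_succ, sum_range_succ]
  have hsum : ∀ j ∈ range x.length,
      (if ∃ h : j + 1 < (x ++ [l] ++ [v]).length,
        (x ++ [l] ++ [v])[j] < (x ++ [l] ++ [v])[j + 1] then 1 else 0) =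
      if ∃ h : j + 1 < (x ++ [l]).length, (x ++ [l])[j] < (x ++ [l])[j + 1] then 1 else 0 := by
    intro j hj
    rw [mem_range] at hj
    have h1 : j + 1 < (x ++ [l]).length := by omega
    have h2 : j + 1 < (x ++ [l] ++ [v]).length := by omega
    simp only [h1, h2, exists_true_left]
    rw [List.getElem_append_left h1, List.getElem_append_left (Nat.lt_of_succ_lt h1)]
  rw [sum_congr rfl hsum]
  simp

theorem isAscentSequence_append_iff (x : List ℕ) (hx : x ≠ []) (v : ℕ) :
    IsAscentSequence (x ++ [v]) ↔ IsAscentSequence x ∧ v ≤ asc x + 1 := by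
  have hpos : 0 < x.length := List.length_pos_iff.2 hx
  constructor
  · rintro ⟨h0, h⟩
    refine ⟨⟨fun hp => ?_, fun i hi hi0 => ?_⟩, ?_⟩
    · simpa [List.getElem_append_left hp] using h0 (by simp)
    · have := h i (by simp; omega) hi0
      rwa [List.getElem_append_left hi, List.take_append_of_le_length hi.le] at this
    · simpa using h x.length (by simp) hpos
  · rintro ⟨⟨h0, h⟩, hv⟩
    refine ⟨fun _ => ?_, fun i hi hi0 => ?_⟩
    · rw [List.getElem_append_left hpos]
      exact h0 hpos
    · rcases lt_or_ge i x.length with hlt | hge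
      · rw [List.getElem_append_left hlt, List.take_append_of_le_length hlt.le]
        exact h i hlt hi0
      · have : i = x.length := by
          simp at hi
          omega
        subst this
        simpa using hv

/-! ### The state of a valid prefix -/

/-- An ascent sequence that avoids `201` and `210`. -/
def Valid (x : List ℕ) : Prop := IsAscentSequence x ∧ Avoids x

/-- The string `x` has the state `s`. The letters of `s.low` are those below the maximum that create
no forbidden pattern; letters from the maximum on never do. -/
structure Tracks (x : List ℕ) (s : State) : Prop where
  asc_eq : asc x = s.ascents
  last_eq : ∃ y, x = y ++ [s.last]
  max_mem : s.max ∈ x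
  le_max : ∀ c ∈ x, c ≤ s.max
  low_lt : ∀ v ∈ s.low, v < s.max
  compatible_iff : ∀ v, Compatible x v ↔ v ∈ s.low ∨ s.max ≤ v
  max_le : s.max ≤ s.ascents + 1

theorem Tracks.append_valid_iff {x : List ℕ} {s : State} (h : Tracks x s) (v : ℕ) :
    Valid (x ++ [v]) ↔ Valid x ∧ v ∈ s.allowed := by
  have hx : x ≠ [] := List.ne_nil_of_mem h.max_mem
  rw [Valid, Valid, isAscentSequence_append_iff x hx, avoids_append_iff, h.compatible_iff, h.asc_eq,
    State.allowed, mem_union, mem_Icc]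
  have := h.low_lt v
  have := h.max_le
  constructor
  · rintro ⟨⟨h1, h2⟩, h3, h4⟩
    exact ⟨⟨h1, h3⟩, h4.imp_right fun h => ⟨h, h2⟩⟩
  · rintro ⟨⟨h1, h3⟩, h4⟩
    refine ⟨⟨h1, ?_⟩, h3, h4.imp_right And.left⟩
    rcases h4 with h4 | h4
    · have := h.low_lt v h4
      omega
    · exact h4.2

theorem Tracks.append {x : List ℕ} {s : State} (h : Tracks x s) {v : ℕ} (hv : v ∈ s.allowed) :
    Tracks (x ++ [v]) (s.step v) := by
  obtain ⟨y, hy⟩ := h.last_eq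
  have hlow := h.low_lt
  have hmax := h.max_le
  have hlast : s.last ≤ s.max := h.le_max _ (by rw [hy]; simp)
  rw [State.allowed, mem_union, mem_Icc] at hv
  refine ⟨?_, ⟨x, rfl⟩, ?_, ?_, ?_, ?_, ?_⟩
  · rw [State.step, ← h.asc_eq, hy, asc_append]
  · rcases le_total v s.max with hle | hle
    · simp [State.step, max_eq_left hle, h.max_mem]
    · simp [State.step, max_eq_right hle]
  · intro c hc
    rcases List.mem_append.1 hc with hc | hc
    · exact (h.le_max c hc).trans (le_max_left _ _)
    · rw [List.mem_singleton.1 hc]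
      exact le_max_right _ _
  · intro w hw
    simp only [State.step] at hw ⊢
    split_ifs at hw with hvm
    · rw [mem_singleton.1 hw]
      exact hvm.trans_le (le_max_left _ _)
    · rw [mem_union, mem_Ico] at hw
      rcases hw with hw | hw
      · exact (hlow w hw).trans_le (le_max_left _ _)
      · exact hw.2.trans_le (le_max_right _ _)
  · intro w
    -- Among the earlier letters, only the maximum matters for the new condition.
    have hc : (∀ c ∈ x, v < c → w < c → v = w) ↔ (v < s.max → w < s.max → v = w) :=
      ⟨fun H => H _ h.max_mem, fun H c hc h1 h2 =>
        H (h1.trans_le (h.le_max c hc)) (h2.trans_le (h.le_max c hc))⟩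
    rw [compatible_append_iff, h.compatible_iff, hc]
    simp only [State.step]
    have hw := hlow w
    split_ifs with hvm
    · have hvl : v ∈ s.low := hv.resolve_right (by omega)
      rw [show s.max.max v = s.max from max_eq_left hvm.le, mem_singleton]
      constructor
      · rintro ⟨_, H⟩
        by_cases hwm : w < s.max
        · exact Or.inl (H hvm hwm).symm
        · exact Or.inr (not_lt.1 hwm)
      · rintro (rfl | H)
        · exact ⟨Or.inl hvl, fun _ _ => rfl⟩
        · exact ⟨Or.inr H, fun _ _ => by omega⟩
    · rw [show s.max.max v = v from max_eq_right (not_lt.1 hvm), mem_union, mem_Ico]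
      by_cases hwl : w ∈ s.low
      · simp [hwl, hvm]
      · simp only [hwl, false_or, hvm, false_imp_iff, and_true]
        omega
  · simp only [State.step]
    by_cases hvm : v ≤ s.max
    · rw [show s.max.max v = s.max from max_eq_left hvm]
      omega
    · rw [show s.max.max v = v from max_eq_right (by omega), if_pos (by omega)]
      have : v ∉ s.low := fun h => hvm (hlow v h).le
      have := hv.resolve_left this
      omega

theorem Valid.of_append {x w : List ℕ} (hx : x ≠ []) (h : Valid (x ++ w)) : Valid x := by
  induction w using List.reverseRecOn with
  | nil => simpa using h
  | append_singleton w v ih =>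
    rw [← List.append_assoc, Valid, isAscentSequence_append_iff _ (by simp [hx]),
      avoids_append_iff] at h
    exact ih ⟨h.1.1, h.2.1⟩

theorem mem_words_iff (n : ℕ) {x : List ℕ} {s : State} (h : Tracks x s) (hx : Valid x)
    (w : List ℕ) : w ∈ words n s ↔ w.length = n ∧ Valid (x ++ w) := by
  induction n generalizing x s w with
  | zero =>
    rw [words, mem_singleton, List.length_eq_zero_iff]
    constructor
    · rintro rfl
      simpa using hx
    · exact And.left
  | succ n ih =>
    simp only [words, mem_biUnion, mem_image]
    constructor
    · rintro ⟨v, hv, u, hu, rfl⟩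
      rw [ih (h.append hv) ((h.append_valid_iff v).2 ⟨hx, hv⟩)] at hu
      simpa using hu
    · rintro ⟨hl, hw⟩
      cases w with
      | nil => simp at hl
      | cons v u =>
        have hw' : Valid (x ++ [v] ++ u) := by simpa using hw
        have hxv := hw'.of_append (by simp)
        have hv := ((h.append_valid_iff v).1 hxv).2
        exact ⟨v, hv, u, (ih (h.append hv) hxv u).2 ⟨by simpa using hl, hw'⟩, rfl⟩

theorem tracks_singleton_zero : Tracks [0] ⟨0, 0, 0, ∅⟩ where
  asc_eq := by simp [asc]
  last_eq := ⟨[], rfl⟩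
  max_mem := by simp
  le_max := by simp
  low_lt := by simp
  compatible_iff := by
    intro v
    simp only [notMem_empty, false_or, Nat.zero_le, iff_true]
    intro c a hs
    simpa using hs.length_le
  max_le := by simp

theorem valid_singleton_zero : Valid [0] := by
  refine ⟨⟨by simp, fun i hi hi0 => ?_⟩, fun c a b hs => ?_⟩
  · simp at hi
    omega
  · simpa using hs.length_le

theorem ascentAvoiders_eq (n : ℕ) :
    ascentAvoiders {[2, 0, 1], [2, 1, 0]} (n + 1) =
      ((words n ⟨0, 0, 0, ∅⟩).image (List.cons 0) : Finset (List ℕ)) := by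
  ext x
  simp only [ascentAvoiders, Set.mem_ofPred_eq, avoids_iff, coe_image, Set.mem_image, mem_coe,
    mem_words_iff n tracks_singleton_zero valid_singleton_zero]
  constructor
  · rintro ⟨hl, h1, h2⟩
    cases x with
    | nil => simp at hl
    | cons v u =>
      have : v = 0 := h1.1 (by simp)
      subst this
      exact ⟨u, ⟨by simpa using hl, h1, h2⟩, rfl⟩
  · rintro ⟨u, ⟨hl, h⟩, rfl⟩
    exact ⟨by simpa using hl, h.1, h.2⟩

end AscentAvoiders

theorem theorem1 (n : ℕ) (hn : 1 ≤ n) :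
    (ascentAvoiders {[2, 0, 1], [2, 1, 0]} n).ncard =
      ∑ k ∈ Finset.range n, (n - 1).choose k * catalan k := by
  obtain ⟨m, rfl⟩ := Nat.exists_eq_add_of_le' hn
  rw [AscentAvoiders.ascentAvoiders_eq, Set.ncard_coe_finset,
    Finset.card_image_of_injective _ List.cons_injective,
    (AscentAvoiders.card_words m).1 0 0 1 ∅ (by simp) rfl]
  simp [AscentAvoiders.binomTransform, AscentAvoiders.contTop_one]
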